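/- Let $\Pi$ be a measure on $(0,\infty)$ with $\int_0^\infty (1\wedge z)\,\Pi(dz)<\infty$ and $\Pi(0,\infty)=\infty$, put $\Phi(\lambda)=\int_0^\infty(1-e^{-\lambda z})\,\Pi(dz)$, and let $H=(H_t)_{t\ge 0}$ be the driftless subordinator with $H_0=0$ and $\mathbf E[e^{-\lambda H_t}]=e^{-t\Phi(\lambda)}$ for $t,\lambda\ge 0$. Suppose that for every $t>0$ the variable $H_t$ has a Lebesgue density; let $h(t,\cdot)\ge 0$ be a version of it with $h(t,z)=0$ for $z\le 0$. Write $$\mathbf D^\Phi_{x+}u(x)=\int_0^\infty (u(x)-u(x-s))\,\Pi(ds),\qquad \mathbf D^\Phi_{x-}u(x)=\int_0^\infty (u(x)-u(x+s))\,\Pi(ds)$$ for the right and left Marchaud-type derivatives. Then for $t>0$ and $x\in\mathbb R$ the function $y\mapsto h(t,y-x)$ is the density of $x+H_t$, and it solves $$\partial_t h=-\mathbf D^\Phi_{y+}h=-\mathbf D^\Phi_{x-}h,\qquad h(0,y-x)=\delta(y-x),$$ in the following sense. (a) Classical sense. Assume that either $h(t,\cdot)$ is locally Lipschitz on $\mathbb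 R$ for every $t>0$, or $h$ is continuous on $(0,\infty)^2$, the integral $\int_0^\infty|h(t,z)-h(t,z-s)|\,\Pi(ds)$ is bounded on compact subsets of $(0,\infty)^2$, and $(t,z)\mapsto\int_0^\infty(h(t,z)-h(t,z-s))\,\Pi(ds)$ is continuous on $(0,\infty)^2$. Then for all $t>0$ and $0<x<y$ the integrals that define $\mathbf D^\Phi_{y+}h(t,y-x)$ and $\mathbf D^\Phi_{x-}h(t,y-x)$ converge absolutely, $\tau\mapsto h(\tau,y-x)$ is differentiable at $t$, and $$\partial_t h(t,y-x)=-\mathbf D^\Phi_{y+}h(t,y-x)=-\mathbf D^\Phi_{x-}h(t,y-x).$$ (b) Sense of distributions, without any regularity of $h$. For all $\varphi\in C_c^\infty(\mathbb R)$, $t>0$ and $x,y\in\mathbb R$, $$\frac{d}{dt}\int\varphi(y)h(t,y-x)\,dy=-\int \mathbf D^\Phi_{y-}\varphi(y)\,h(t,y-x)\,dy,\qquad \frac{d}{dt}\int\varphi(x)h(t,y-x)\,dx=-\int \mathbf D^\Phi_{x+}\varphi(x)\,h(t,y-x)\,dx .$$ (c) Initial condition. For every bounded continuous $\varphi:\mathbb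 R\to\mathbb R$ and all $x,y\in\mathbb R$, as $t\downarrow 0$, $$\int\varphi(y)h(t,y-x)\,dy\to\varphi(x),\qquad \int\varphi(x)h(t,y-x)\,dx\to\varphi(y).$$ -/

import Mathlib

open MeasureTheory ProbabilityTheory Filter Set
open scoped NNReal ENNReal Topology

noncomputable section

/-- A Lévy measure of a subordinator: carried by `(0, ∞)` and integrating `1 ∧ z`. -/
structure IsSubordinatorLevyMeasure (ν : Measure ℝ) : Prop where
  null_Iic : ν (Iic 0) = 0
  lintegral_min_lt_top : ∫⁻ z in Ioi (0 : ℝ), ENNReal.ofReal (min 1 z) ∂ν < ∞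

/-- The symbol `Φ(λ) = ∫_{(0,∞)} (1 - e^{-λ z}) ν(dz)` (no killing, no drift). -/
def levySymbol (ν : Measure ℝ) (l : ℝ) : ℝ :=
  ∫ z in Ioi (0 : ℝ), (1 - Real.exp (-l * z)) ∂ν

/-- `H` is, under `P`, a subordinator started at `0`, without killing and drift, whose Lévy
measure is `ν`. -/
structure IsDriftlessSubordinator {Ω : Type*} [MeasurableSpace Ω] (P : Measure Ω)
    (H : ℝ≥0 → Ω → ℝ) (ν : Measure ℝ) : Prop where
  levy : IsSubordinatorLevyMeasure ν
  measurable : ∀ t, Measurable (H t)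
  start_zero : ∀ᵐ ω ∂P, H 0 ω = 0
  mono_paths : ∀ᵐ ω ∂P, Monotone fun t => H t ω
  rightCont_paths : ∀ᵐ ω ∂P, ∀ t, ContinuousWithinAt (fun s => H s ω) (Ici t) t
  indep_increments : HasIndepIncrements H P
  stationary_increments : ∀ s t : ℝ≥0, P.map (fun ω => H (s + t) ω - H s ω) = P.map (H t)
  laplace : ∀ (t : ℝ≥0) (l : ℝ), 0 ≤ l →
    ∫ ω, Real.exp (-l * H t ω) ∂P = Real.exp (-(t : ℝ) * levySymbol ν l)

/-- `h t` is, for every `t > 0`, a version of the Lebesgue density of `H t`, extended by zero to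
the non-positive half-line. -/
structure IsTransitionDensity {Ω : Type*} [MeasurableSpace Ω] (P : Measure Ω)
    (H : ℝ≥0 → Ω → ℝ) (h : ℝ → ℝ → ℝ) : Prop where
  measurable : ∀ t, 0 < t → Measurable (h t)
  nonneg : ∀ t, 0 < t → ∀ z, 0 ≤ h t z
  eq_zero : ∀ t, 0 < t → ∀ z ≤ 0, h t z = 0
  law : ∀ t : ℝ≥0, 0 < t →
    P.map (H t) = volume.withDensity fun z => ENNReal.ofReal (h t z)

/-- Right Marchaud-type derivative `𝐃_{x+} u (x) = ∫_{(0,∞)} (u(x) - u(x - s)) ν(ds)`. -/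
def marchaudRight (ν : Measure ℝ) (u : ℝ → ℝ) (x : ℝ) : ℝ :=
  ∫ s in Ioi (0 : ℝ), (u x - u (x - s)) ∂ν

/-- Left Marchaud-type derivative `𝐃_{x-} u (x) = ∫_{(0,∞)} (u(x) - u(x + s)) ν(ds)`. -/
def marchaudLeft (ν : Measure ℝ) (u : ℝ → ℝ) (x : ℝ) : ℝ :=
  ∫ s in Ioi (0 : ℝ), (u x - u (x + s)) ∂ν

/-- `h` is continuous on `(0,∞) × (0,∞)`, and there the Marchaud integral of `h t` converges
absolutely, locally boundedly, to a continuous function of `(t, z)`. This allows `h t` to be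
discontinuous or unbounded at the origin, as for small times of the gamma subordinator. -/
structure MarchaudRegular (ν : Measure ℝ) (h : ℝ → ℝ → ℝ) : Prop where
  continuousOn : ContinuousOn (fun p : ℝ × ℝ => h p.1 p.2) (Ioi 0 ×ˢ Ioi 0)
  bounded : ∀ K : Set (ℝ × ℝ), IsCompact K → K ⊆ Ioi 0 ×ˢ Ioi 0 →
    ∃ C : ℝ≥0, ∀ p ∈ K, ∫⁻ s in Ioi (0 : ℝ), ‖h p.1 p.2 - h p.1 (p.2 - s)‖ₑ ∂ν ≤ C
  marchaud_continuousOn :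
    ContinuousOn (fun p : ℝ × ℝ => marchaudRight ν (h p.1) p.2) (Ioi 0 ×ˢ Ioi 0)

end

/-!
Write `u = e^{-w}`. The Laplace transforms of `H t` are the moments
`E[(e^{-H t})^n] = e^{-t Φ(n)}`, and the operator `F ↦ ∫ (F u - F (u e^{-s})) ν(ds)` multiplies
`u^n` by `Φ(n)`. Hence `E[F (e^{-H t})]` solves the evolution equation of this operator when `F` is
a polynomial, and by `C¹` approximation on `[0, 1]` for every `F` of class `C¹`; test functions have
this form, which is the equation in the sense of distributions. Where the Marchaud integral of the
density is locally bounded, Fubini moves the operator from the test function to the density, and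
test functions shrinking to a point give the classical equation.

If the densities are locally Lipschitz, the Chapman–Kolmogorov identity
`h (s + t) z = E[h t (z - H s)]` passes the Lipschitz bound at one time on to all later times, so
that the Marchaud integrals converge locally uniformly and are continuous.
-/

theorem exp_neg_mem_Icc {w : ℝ} (hw : 0 ≤ w) : Real.exp (-w) ∈ Icc (0 : ℝ) 1 :=
  ⟨(Real.exp_pos _).le, Real.exp_le_one_iff.2 (neg_nonpos.2 hw)⟩

theorem min_one_le_two_mul_one_sub_exp_neg {s : ℝ} (hs : 0 ≤ s) :
    min 1 s ≤ 2 * (1 - Real.exp (-s)) := by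
  have hexp : Real.exp (-s) * (1 + s) ≤ 1 := by
    rw [Real.exp_neg, inv_mul_le_one₀ (Real.exp_pos s), add_comm]
    exact Real.add_one_le_exp s
  rcases le_total s 1 with h | h
  · rw [min_eq_right h]
    nlinarith [Real.exp_pos (-s)]
  · rw [min_eq_left h]
    nlinarith [Real.exp_pos (-s)]

theorem levySymbol_one (ν : Measure ℝ) :
    levySymbol ν 1 = ∫ s in Ioi (0 : ℝ), (1 - Real.exp (-s)) ∂ν := by
  simp only [levySymbol, neg_mul, one_mul]

namespace IsSubordinatorLevyMeasure

variable {ν : Measure ℝ} (hν : IsSubordinatorLevyMeasure ν)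
include hν

theorem integrableOn_one_sub_exp_neg :
    IntegrableOn (fun s : ℝ => 1 - Real.exp (-s)) (Ioi 0) ν := by
  have hmin : IntegrableOn (fun s : ℝ => min 1 s) (Ioi 0) ν := by
    refine ⟨by fun_prop, (hasFiniteIntegral_iff_ofReal ?_).2 hν.lintegral_min_lt_top⟩
    filter_upwards [ae_restrict_mem measurableSet_Ioi] with s hs
    exact le_min zero_le_one (le_of_lt hs)
  refine hmin.mono' (by fun_prop) ?_
  filter_upwards [ae_restrict_mem measurableSet_Ioi] with s hs
  rw [Real.norm_of_nonneg (sub_nonneg.2 (exp_neg_mem_Icc (le_of_lt hs)).2)]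
  exact le_min (sub_le_self _ (Real.exp_pos _).le) (by linarith [Real.add_one_le_exp (-s)])

theorem sFinite_restrict_Ioi : SFinite (ν.restrict (Ioi 0)) := by
  set f : ℝ → ℝ≥0∞ := fun z => ENNReal.ofReal (min 1 z) with hf
  have : IsFiniteMeasure ((ν.restrict (Ioi 0)).withDensity f) :=
    isFiniteMeasure_withDensity hν.lintegral_min_lt_top.ne
  have hpos : ∀ᵐ z ∂ν.restrict (Ioi 0), f z ≠ 0 := by
    filter_upwards [ae_restrict_mem measurableSet_Ioi] with s hs
    simpa [hf] using hs
  rw [← withDensity_inv_same (by fun_prop) hpos (by simp [hf])]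
  infer_instance

theorem integrableOn_of_abs_le {g : ℝ → ℝ} (hg : AEStronglyMeasurable g (ν.restrict (Ioi 0)))
    {C : ℝ} (hC : ∀ s, 0 < s → |g s| ≤ C * (1 - Real.exp (-s))) : IntegrableOn g (Ioi 0) ν :=
  (hν.integrableOn_one_sub_exp_neg.const_mul C).mono' hg
    (ae_restrict_of_forall_mem measurableSet_Ioi fun s hs => hC s hs)

theorem abs_setIntegral_le {g : ℝ → ℝ} {C : ℝ}
    (hC : ∀ s, 0 < s → |g s| ≤ C * (1 - Real.exp (-s))) :
    |∫ s in Ioi 0, g s ∂ν| ≤ C * levySymbol ν 1 := by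
  rw [levySymbol_one, ← integral_const_mul]
  exact norm_integral_le_of_norm_le (f := g) (hν.integrableOn_one_sub_exp_neg.const_mul C)
    (ae_restrict_of_forall_mem measurableSet_Ioi fun s hs => hC s hs)

theorem setLIntegral_enorm_le {g : ℝ → ℝ} {C : ℝ}
    (hC : ∀ s, 0 < s → |g s| ≤ C * (1 - Real.exp (-s))) :
    ∫⁻ s in Ioi 0, ‖g s‖ₑ ∂ν ≤ ENNReal.ofReal (C * levySymbol ν 1) := by
  rw [levySymbol_one, ← integral_const_mul, ofReal_integral_eq_lintegral_ofReal
    (hν.integrableOn_one_sub_exp_neg.const_mul C)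
    (ae_restrict_of_forall_mem measurableSet_Ioi fun s hs => (abs_nonneg _).trans (hC s hs))]
  refine setLIntegral_mono' measurableSet_Ioi fun s hs => ?_
  rw [← ofReal_norm]
  exact ENNReal.ofReal_le_ofReal (hC s hs)

theorem measurable_marchaudRight {f : ℝ → ℝ} (hf : Measurable f) :
    Measurable (marchaudRight ν f) := by
  have := hν.sFinite_restrict_Ioi
  have hdiff : StronglyMeasurable fun p : ℝ × ℝ => f p.1 - f (p.1 - p.2) :=
    Measurable.stronglyMeasurable (by fun_prop)
  exact (hdiff.integral_prod_right' (ν := ν.restrict (Ioi 0))).measurable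

theorem measurable_marchaudLeft {f : ℝ → ℝ} (hf : Measurable f) :
    Measurable (marchaudLeft ν f) := by
  have := hν.sFinite_restrict_Ioi
  have hdiff : StronglyMeasurable fun p : ℝ × ℝ => f p.1 - f (p.1 + p.2) :=
    Measurable.stronglyMeasurable (by fun_prop)
  exact (hdiff.integral_prod_right' (ν := ν.restrict (Ioi 0))).measurable

end IsSubordinatorLevyMeasure

/-- The negative generator of the subordinator in the multiplicative coordinate `u = e^{-w}`, in
which the jump `w ↦ w + s` becomes the dilation `u ↦ u e^{-s}`. -/
noncomputable def dilationDefect (ν : Measure ℝ) (F : ℝ → ℝ) (u : ℝ) : ℝ :=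
  ∫ s in Ioi (0 : ℝ), (F u - F (u * Real.exp (-s))) ∂ν

theorem abs_sub_dilation_le {F : ℝ → ℝ} {K : ℝ≥0} (hF : LipschitzOnWith K F (Icc 0 1)) {u s : ℝ}
    (hu : u ∈ Icc (0 : ℝ) 1) (hs : 0 ≤ s) :
    |F u - F (u * Real.exp (-s))| ≤ K * (1 - Real.exp (-s)) := by
  obtain ⟨he0, he1⟩ := exp_neg_mem_Icc hs
  refine (hF.dist_le_mul u hu _ ⟨mul_nonneg hu.1 he0, mul_le_one₀ hu.2 he0 he1⟩).trans ?_
  gcongr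
  calc dist u (u * Real.exp (-s)) = u * (1 - Real.exp (-s)) := by
        rw [Real.dist_eq, ← mul_one_sub, abs_of_nonneg (mul_nonneg hu.1 (sub_nonneg.2 he1))]
    _ ≤ 1 - Real.exp (-s) := mul_le_of_le_one_left (sub_nonneg.2 he1) hu.2

theorem dilationDefect_pow (ν : Measure ℝ) (n : ℕ) (u : ℝ) :
    dilationDefect ν (fun v => v ^ n) u = levySymbol ν n * u ^ n := by
  simp only [dilationDefect, levySymbol, ← integral_mul_const, mul_pow, ← Real.exp_nat_mul,
    mul_neg, neg_mul, one_sub_mul, mul_comm (u ^ n)]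

section DilationDefect

variable {ν : Measure ℝ} (hν : IsSubordinatorLevyMeasure ν)
include hν

theorem integrableOn_sub_dilation {F : ℝ → ℝ} (hFm : Measurable F) {K : ℝ≥0}
    (hF : LipschitzOnWith K F (Icc 0 1)) {u : ℝ} (hu : u ∈ Icc (0 : ℝ) 1) :
    IntegrableOn (fun s => F u - F (u * Real.exp (-s))) (Ioi 0) ν :=
  hν.integrableOn_of_abs_le (Measurable.aestronglyMeasurable (by fun_prop))
    fun _ hs => abs_sub_dilation_le hF hu hs.le

theorem abs_dilationDefect_le {F : ℝ → ℝ} {K : ℝ≥0} (hF : LipschitzOnWith K F (Icc 0 1)) {u : ℝ}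
    (hu : u ∈ Icc (0 : ℝ) 1) : |dilationDefect ν F u| ≤ K * levySymbol ν 1 :=
  hν.abs_setIntegral_le fun _ hs => abs_sub_dilation_le hF hu hs.le

theorem dilationDefect_sub {F G : ℝ → ℝ} (hFm : Measurable F) (hGm : Measurable G) {K L : ℝ≥0}
    (hF : LipschitzOnWith K F (Icc 0 1)) (hG : LipschitzOnWith L G (Icc 0 1)) {u : ℝ}
    (hu : u ∈ Icc (0 : ℝ) 1) :
    dilationDefect ν (fun v => F v - G v) u = dilationDefect ν F u - dilationDefect ν G u := by
  unfold dilationDefect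
  rw [← integral_sub (integrableOn_sub_dilation hν hFm hF hu)
    (integrableOn_sub_dilation hν hGm hG hu)]
  congr 1 with s
  ring

theorem dilationDefect_polynomial_eval (p : Polynomial ℝ) {u : ℝ} (hu : u ∈ Icc (0 : ℝ) 1) :
    dilationDefect ν (fun v => p.eval v) u = p.sum fun n a => a * (levySymbol ν n * u ^ n) := by
  have hpow : ∀ n : ℕ,
      IntegrableOn (fun s => u ^ n - (u * Real.exp (-s)) ^ n) (Ioi 0) ν := fun n => by
    obtain ⟨K, hK⟩ := (contDiff_id.pow n).contDiffOn.exists_lipschitzOnWith one_ne_zero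
      (convex_Icc (0 : ℝ) 1) isCompact_Icc
    exact integrableOn_sub_dilation hν (by fun_prop) hK hu
  simp only [dilationDefect, Polynomial.eval_eq_sum, Polynomial.sum, ← Finset.sum_sub_distrib,
    ← mul_sub]
  rw [integral_finsetSum _ fun n _ => (hpow n).const_mul _]
  simp only [integral_const_mul, ← dilationDefect_pow, dilationDefect]

theorem measurable_dilationDefect {F : ℝ → ℝ} (hF : Measurable F) :
    Measurable (dilationDefect ν F) := by
  have := hν.sFinite_restrict_Ioi
  have hdiff : StronglyMeasurable fun p : ℝ × ℝ => F p.1 - F (p.1 * Real.exp (-p.2)) :=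
    Measurable.stronglyMeasurable (by fun_prop)
  exact (hdiff.integral_prod_right' (ν := ν.restrict (Ioi 0))).measurable

end DilationDefect

theorem exists_polynomial_derivative_eq {K : Type*} [Field K] [CharZero K] (q : Polynomial K)
    (c : K) : ∃ p : Polynomial K, p.derivative = q ∧ p.eval 0 = c := by
  suffices h : ∃ p : Polynomial K, p.derivative = q by
    obtain ⟨p, hp⟩ := h
    exact ⟨p + Polynomial.C (c - p.eval 0), by simp [hp], by simp⟩
  induction q using Polynomial.induction_on' with
  | add p q hp hq =>
    obtain ⟨p', rfl⟩ := hp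
    obtain ⟨q', rfl⟩ := hq
    exact ⟨p' + q', Polynomial.derivative_add⟩
  | monomial n a =>
    refine ⟨Polynomial.monomial (n + 1) (a / (n + 1)), ?_⟩
    simp [n.cast_add_one_ne_zero]

theorem exists_lipschitzOnWith_sub_polynomial {F : ℝ → ℝ} (hF : ContDiff ℝ 1 F) {ε : ℝ≥0}
    (hε : 0 < ε) :
    ∃ p : Polynomial ℝ, (∀ u ∈ Icc (0 : ℝ) 1, |F u - p.eval u| ≤ ε) ∧
      LipschitzOnWith ε (fun u => F u - p.eval u) (Icc 0 1) := by
  obtain ⟨q, hq⟩ := exists_polynomial_near_of_continuousOn 0 1 (deriv F)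
    (hF.continuous_deriv le_rfl).continuousOn ε hε
  obtain ⟨p, rfl, hp0⟩ := exists_polynomial_derivative_eq q (F 0)
  have hFd := hF.differentiable one_ne_zero
  have hlip : LipschitzOnWith ε (fun u => F u - p.eval u) (Icc 0 1) := by
    refine (convex_Icc (0 : ℝ) 1).lipschitzOnWith_of_nnnorm_deriv_le
      (fun u _ => (hFd u).sub p.differentiableAt) fun u hu => ?_
    rw [deriv_fun_sub (hFd u) p.differentiableAt, Polynomial.deriv, ← NNReal.coe_le_coe,
      coe_nnnorm, norm_sub_rev]
    exact (hq u hu).le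
  refine ⟨p, fun u hu => ?_, hlip⟩
  have hsub := hlip.dist_le_mul u hu 0 (by simp)
  rw [hp0, sub_self, dist_zero_right, dist_zero_right, Real.norm_of_nonneg hu.1] at hsub
  exact hsub.trans (mul_le_of_le_one_right ε.2 hu.2)

namespace IsDriftlessSubordinator

variable {Ω : Type*} [MeasurableSpace Ω] {P : Measure Ω} {H : ℝ≥0 → Ω → ℝ} {ν : Measure ℝ}
  (hH : IsDriftlessSubordinator P H ν)
include hH

theorem isProbabilityMeasure : IsProbabilityMeasure P := by
  refine ⟨?_⟩
  have hreal : P.real univ = 1 := by simpa using hH.laplace 0 0 le_rfl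
  rwa [measureReal_def, ENNReal.toReal_eq_one_iff] at hreal

theorem ae_nonneg (t : ℝ≥0) : ∀ᵐ ω ∂P, 0 ≤ H t ω := by
  filter_upwards [hH.start_zero, hH.mono_paths] with ω h0 hmono
  rw [← h0]
  exact hmono (zero_le : 0 ≤ t)

theorem map_add (s t : ℝ≥0) : P.map (H (s + t)) = P.map (H s) ∗ P.map (H t) := by
  have := hH.isProbabilityMeasure
  have hind : IndepFun (H s) (H (s + t) - H s) P :=
    hH.indep_increments.indepFun_eval_sub zero_le le_self_add hH.start_zero
  have hsum := hind.map_add_eq_map_conv_map (hH.measurable s)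
    ((hH.measurable (s + t)).sub (hH.measurable s))
  have hinc : P.map (H (s + t) - H s) = P.map (H t) := hH.stationary_increments s t
  rwa [add_sub_cancel, hinc] at hsum

theorem integrable_comp_exp_neg {G : ℝ → ℝ} (hG : Measurable G) {C : ℝ}
    (hC : ∀ u ∈ Icc (0 : ℝ) 1, |G u| ≤ C) (t : ℝ≥0) :
    Integrable (fun ω => G (Real.exp (-H t ω))) P := by
  have := hH.isProbabilityMeasure
  have := hH.measurable t
  refine (integrable_const C).mono' (Measurable.aestronglyMeasurable (by fun_prop)) ?_
  filter_upwards [hH.ae_nonneg t] with ω hω using hC _ (exp_neg_mem_Icc hω)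

theorem abs_integral_comp_exp_neg_le {G : ℝ → ℝ} {C : ℝ} (hC : ∀ u ∈ Icc (0 : ℝ) 1, |G u| ≤ C)
    (t : ℝ≥0) : |∫ ω, G (Real.exp (-H t ω)) ∂P| ≤ C := by
  have := hH.isProbabilityMeasure
  have hbound : ∀ᵐ ω ∂P, ‖G (Real.exp (-H t ω))‖ ≤ C := by
    filter_upwards [hH.ae_nonneg t] with ω hω using hC _ (exp_neg_mem_Icc hω)
  simpa using norm_integral_le_of_norm_le_const hbound

theorem integrable_continuous_comp_exp_neg {F : ℝ → ℝ} (hF : Continuous F) (t : ℝ≥0) :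
    Integrable (fun ω => F (Real.exp (-H t ω))) P := by
  obtain ⟨C, hC⟩ := isCompact_Icc.exists_bound_of_continuousOn (hF.continuousOn (s := Icc 0 1))
  exact hH.integrable_comp_exp_neg hF.measurable hC t

theorem integral_one_sub_exp_neg (t : ℝ≥0) :
    ∫ ω, (1 - Real.exp (-H t ω)) ∂P = 1 - Real.exp (-(t * levySymbol ν 1)) := by
  have := hH.isProbabilityMeasure
  have hexp := hH.laplace t 1 zero_le_one
  simp only [neg_mul, one_mul] at hexp
  have hint : Integrable (fun ω => Real.exp (-H t ω)) P :=
    hH.integrable_continuous_comp_exp_neg continuous_id t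
  rw [integral_sub (integrable_const 1) hint, hexp, integral_const, probReal_univ, one_smul]

theorem integrable_dilationDefect_comp_exp_neg {F : ℝ → ℝ} (hF : ContDiff ℝ 1 F) (t : ℝ≥0) :
    Integrable (fun ω => dilationDefect ν F (Real.exp (-H t ω))) P := by
  obtain ⟨K, hK⟩ := hF.contDiffOn.exists_lipschitzOnWith one_ne_zero (convex_Icc (0 : ℝ) 1)
    isCompact_Icc
  exact hH.integrable_comp_exp_neg (measurable_dilationDefect hH.levy hF.continuous.measurable)
    (fun _ hu => abs_dilationDefect_le hH.levy hK hu) t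

theorem integral_polynomial_comp_exp_neg (p : Polynomial ℝ) (c : ℕ → ℝ) (t : ℝ≥0) :
    ∫ ω, (p.sum fun n a => a * (c n * Real.exp (-H t ω) ^ n)) ∂P =
      p.sum fun n a => a * (c n * Real.exp (-t * levySymbol ν n)) := by
  have hmoment : ∀ n : ℕ,
      ∫ ω, Real.exp (-H t ω) ^ n ∂P = Real.exp (-t * levySymbol ν n) := fun n => by
    rw [← hH.laplace t n n.cast_nonneg]
    simp only [← Real.exp_nat_mul, mul_neg, neg_mul]
  simp only [Polynomial.sum]
  rw [integral_finsetSum _ fun n _ =>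
    ((hH.integrable_continuous_comp_exp_neg (continuous_pow n) t).const_mul _).const_mul _]
  simp only [integral_const_mul, hmoment]

theorem hasDerivAt_integral_polynomial_comp_exp_neg (p : Polynomial ℝ) {t : ℝ} (ht : 0 < t) :
    HasDerivAt (fun τ : ℝ => ∫ ω, p.eval (Real.exp (-H τ.toNNReal ω)) ∂P)
      (-∫ ω, dilationDefect ν (fun u => p.eval u) (Real.exp (-H t.toNNReal ω)) ∂P) t := by
  have heval : ∀ τ : ℝ, 0 < τ → ∫ ω, p.eval (Real.exp (-H τ.toNNReal ω)) ∂P =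
      p.sum fun n a => a * Real.exp (-τ * levySymbol ν n) := fun τ hτ => by
    simpa only [Polynomial.eval_eq_sum, Pi.one_apply, one_mul, Real.coe_toNNReal τ hτ.le] using
      hH.integral_polynomial_comp_exp_neg p 1 τ.toNNReal
  have hdefect : ∫ ω, dilationDefect ν (fun u => p.eval u) (Real.exp (-H t.toNNReal ω)) ∂P =
      p.sum fun n a => a * (levySymbol ν n * Real.exp (-t * levySymbol ν n)) := by
    rw [← Real.coe_toNNReal t ht.le,
      ← hH.integral_polynomial_comp_exp_neg p (fun n => levySymbol ν n), Real.coe_toNNReal t ht.le]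
    refine integral_congr_ae ?_
    filter_upwards [hH.ae_nonneg t.toNNReal] with ω hω
    exact dilationDefect_polynomial_eval hH.levy p (exp_neg_mem_Icc hω)
  have hsum : HasDerivAt (fun τ => p.sum fun n a => a * Real.exp (-τ * levySymbol ν n))
      (-p.sum fun n a => a * (levySymbol ν n * Real.exp (-t * levySymbol ν n))) t := by
    simp only [Polynomial.sum, ← Finset.sum_neg_distrib]
    refine HasDerivAt.fun_sum fun n _ => ?_
    exact (((hasDerivAt_neg t).mul_const (levySymbol ν n)).exp.const_mul
      (p.coeff n)).congr_deriv (by ring)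
  rw [hdefect]
  refine hsum.congr_of_eventuallyEq ?_
  filter_upwards [lt_mem_nhds ht] with τ hτ using heval τ hτ

theorem abs_integral_dilationDefect_sub_le {F G : ℝ → ℝ} (hF : ContDiff ℝ 1 F)
    (hG : ContDiff ℝ 1 G) {ε : ℝ≥0} (hε : LipschitzOnWith ε (fun u => F u - G u) (Icc 0 1))
    (t : ℝ≥0) :
    |∫ ω, dilationDefect ν F (Real.exp (-H t ω)) ∂P -
      ∫ ω, dilationDefect ν G (Real.exp (-H t ω)) ∂P| ≤ ε * levySymbol ν 1 := by
  obtain ⟨K, hK⟩ := hF.contDiffOn.exists_lipschitzOnWith one_ne_zero (convex_Icc (0 : ℝ) 1)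
    isCompact_Icc
  obtain ⟨L, hL⟩ := hG.contDiffOn.exists_lipschitzOnWith one_ne_zero (convex_Icc (0 : ℝ) 1)
    isCompact_Icc
  rw [← integral_sub (hH.integrable_dilationDefect_comp_exp_neg hF t)
    (hH.integrable_dilationDefect_comp_exp_neg hG t)]
  refine hH.abs_integral_comp_exp_neg_le
    (G := fun u => dilationDefect ν F u - dilationDefect ν G u) (fun u hu => ?_) t
  rw [← dilationDefect_sub hH.levy hF.continuous.measurable hG.continuous.measurable hK hL hu]
  exact abs_dilationDefect_le hH.levy hε hu

theorem hasDerivAt_integral_comp_exp_neg {F : ℝ → ℝ} (hF : ContDiff ℝ 1 F) {t : ℝ} (ht : 0 < t) :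
    HasDerivAt (fun τ : ℝ => ∫ ω, F (Real.exp (-H τ.toNNReal ω)) ∂P)
      (-∫ ω, dilationDefect ν F (Real.exp (-H t.toNNReal ω)) ∂P) t := by
  let ε : ℕ → ℝ≥0 := fun n => 1 / (n + 1)
  have hε : Tendsto (fun n => (ε n : ℝ)) atTop (𝓝 0) := by
    simpa [ε] using tendsto_one_div_add_atTop_nhds_zero_nat (𝕜 := ℝ)
  choose p hp hlip using fun n =>
    exists_lipschitzOnWith_sub_polynomial hF (ε := ε n) (by positivity)
  refine hasDerivAt_of_tendstoUniformlyOn (l := atTop) isOpen_Ioi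
    (f := fun n (τ : ℝ) => ∫ ω, (p n).eval (Real.exp (-H τ.toNNReal ω)) ∂P)
    (f' := fun n (τ : ℝ) => -∫ ω, dilationDefect ν (fun u => (p n).eval u)
      (Real.exp (-H τ.toNNReal ω)) ∂P)
    (g' := fun (τ : ℝ) => -∫ ω, dilationDefect ν F (Real.exp (-H τ.toNNReal ω)) ∂P)
    ?_ (Eventually.of_forall fun n τ hτ =>
      hH.hasDerivAt_integral_polynomial_comp_exp_neg (p n) hτ) (fun τ _ => ?_) ht
  · have hεΦ : Tendsto (fun n => (ε n : ℝ) * levySymbol ν 1) atTop (𝓝 0) := by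
      simpa using hε.mul_const (levySymbol ν 1)
    refine Metric.tendstoUniformlyOn_iff.2 fun δ hδ => ?_
    filter_upwards [hεΦ.eventually (gt_mem_nhds hδ)] with n hn τ _
    rw [dist_neg_neg]
    exact (hH.abs_integral_dilationDefect_sub_le hF ((p n).contDiff_aeval 1) (hlip n) _).trans_lt hn
  · refine tendsto_iff_dist_tendsto_zero.2 (squeeze_zero (fun _ => dist_nonneg) (fun n => ?_) hε)
    rw [dist_comm, Real.dist_eq,
      ← integral_sub (hH.integrable_continuous_comp_exp_neg hF.continuous _)
        (hH.integrable_continuous_comp_exp_neg (p n).continuous _)]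
    exact hH.abs_integral_comp_exp_neg_le (hp n) _

end IsDriftlessSubordinator

theorem exists_contDiff_comp_exp_neg {n : WithTop ℕ∞} {φ : ℝ → ℝ} (hφ : ContDiff ℝ n φ)
    (hzero : φ =ᶠ[atTop] 0) (x : ℝ) :
    ∃ F : ℝ → ℝ, ContDiff ℝ n F ∧ ∀ w, F (Real.exp (-w)) = φ (x + w) := by
  obtain ⟨R, hR⟩ := eventually_atTop.1 hzero
  refine ⟨fun u => if u ≤ 0 then 0 else φ (x - Real.log u), ?_, fun w => by simp [Real.exp_pos]⟩
  refine contDiff_iff_contDiffAt.2 fun u => ?_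
  rcases lt_or_ge 0 u with hu | hu
  · have hlog : ContDiffAt ℝ n (fun v => x - Real.log v) u :=
      contDiffAt_const.sub (Real.contDiffAt_log.2 hu.ne')
    refine (hφ.contDiffAt.comp u hlog).congr_of_eventuallyEq ?_
    filter_upwards [lt_mem_nhds hu] with v hv
    simp only [not_le.2 hv, if_false, Function.comp_apply]
  · refine (contDiffAt_const (c := (0 : ℝ))).congr_of_eventuallyEq ?_
    filter_upwards [gt_mem_nhds (hu.trans_lt (Real.exp_pos (x - R)))] with v hv
    split_ifs with hv0
    · rfl
    · have hlog := (Real.log_lt_iff_lt_exp (not_le.1 hv0)).2 hv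
      exact hR _ (by linarith)

theorem dilationDefect_comp_exp_neg {ν : Measure ℝ} {F φ : ℝ → ℝ} {x : ℝ}
    (hF : ∀ w, F (Real.exp (-w)) = φ (x + w)) (w : ℝ) :
    dilationDefect ν F (Real.exp (-w)) = marchaudLeft ν φ (x + w) := by
  simp only [dilationDefect, marchaudLeft, ← Real.exp_add, ← neg_add, hF, add_assoc]

theorem marchaudLeft_comp_neg (ν : Measure ℝ) (φ : ℝ → ℝ) (x : ℝ) :
    marchaudLeft ν (fun y => φ (-y)) x = marchaudRight ν φ (-x) := by
  simp only [marchaudLeft, marchaudRight, neg_add, sub_eq_add_neg]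

theorem integral_comp_neg_mul_comp_sub_neg (φ g : ℝ → ℝ) (y : ℝ) :
    ∫ x, φ (-x) * g (x - -y) = ∫ x, φ x * g (y - x) := by
  rw [← integral_neg_eq_self]
  simp only [neg_neg, sub_neg_eq_add, neg_add_eq_sub]

theorem map_const_add_withDensity {G : Type*} [MeasurableSpace G] [AddGroup G] [MeasurableAdd G]
    (μ : Measure G) [μ.IsAddLeftInvariant] (f : G → ℝ≥0∞) (g : G) :
    (μ.withDensity f).map (g + ·) = μ.withDensity fun y => f (-g + y) := by
  ext s hs
  have hm : Measurable (g + · : G → G) := measurable_const_add g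
  rw [Measure.map_apply hm hs, withDensity_apply _ (hm hs), withDensity_apply _ hs,
    ← lintegral_indicator (hm hs), ← lintegral_indicator hs,
    ← lintegral_add_left_eq_self (s.indicator fun y => f (-g + y)) g]
  simp only [indicator, mem_preimage, neg_add_cancel_left]
  rfl

namespace IsTransitionDensity

variable {Ω : Type*} [MeasurableSpace Ω] {P : Measure Ω} {H : ℝ≥0 → Ω → ℝ} {ν : Measure ℝ}
  {h : ℝ → ℝ → ℝ}

theorem map_toNNReal (hh : IsTransitionDensity P H h) {t : ℝ} (ht : 0 < t) :
    P.map (H t.toNNReal) = volume.withDensity fun z => ENNReal.ofReal (h t z) := by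
  simpa only [Real.coe_toNNReal t ht.le] using hh.law t.toNNReal (Real.toNNReal_pos.2 ht)

section

variable (hH : IsDriftlessSubordinator P H ν) (hh : IsTransitionDensity P H h)
include hH hh

theorem map_const_add {t : ℝ≥0} (ht : 0 < t) (x : ℝ) :
    P.map (fun ω => x + H t ω) = volume.withDensity fun y => ENNReal.ofReal (h t (y - x)) := by
  simp only [sub_eq_neg_add]
  rw [← map_const_add_withDensity volume (fun z => ENNReal.ofReal (h t z)), ← hh.law t ht,
    Measure.map_map (measurable_const_add x) (hH.measurable t)]
  rfl

theorem integral_mul_comp_sub {t : ℝ} (ht : 0 < t) {φ : ℝ → ℝ} (hφ : Measurable φ) (x : ℝ) :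
    ∫ y, φ y * h t (y - x) = ∫ ω, φ (x + H t.toNNReal ω) ∂P := by
  have hpos : 0 < t.toNNReal := Real.toNNReal_pos.2 ht
  have hm : Measurable fun y => h t (y - x) := (hh.measurable t ht).comp (by fun_prop)
  rw [← integral_map (φ := fun ω => x + H t.toNNReal ω)
      ((hH.measurable _).const_add x).aemeasurable hφ.aestronglyMeasurable,
    hh.map_const_add hH hpos, Real.coe_toNNReal t ht.le,
    integral_withDensity_eq_integral_toReal_smul hm.ennreal_ofReal (by simp)]
  simp only [ENNReal.toReal_ofReal (hh.nonneg t ht _), smul_eq_mul, mul_comm]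

theorem integrable {t : ℝ} (ht : 0 < t) : Integrable (h t) := by
  have := hH.isProbabilityMeasure
  refine ⟨(hh.measurable t ht).aestronglyMeasurable, ?_⟩
  rw [hasFiniteIntegral_iff_ofReal (ae_of_all _ (hh.nonneg t ht)), ← setLIntegral_univ,
    ← withDensity_apply _ MeasurableSet.univ, ← hh.map_toNNReal ht]
  exact measure_lt_top _ _

theorem hasDerivAt_integral_forward {φ : ℝ → ℝ} (hφ : ContDiff ℝ 1 φ) (hzero : φ =ᶠ[atTop] 0)
    {t : ℝ} (ht : 0 < t) (x : ℝ) :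
    HasDerivAt (fun τ => ∫ y, φ y * h τ (y - x))
      (-∫ y, marchaudLeft ν φ y * h t (y - x)) t := by
  obtain ⟨F, hF, hFφ⟩ := exists_contDiff_comp_exp_neg hφ hzero x
  have hderiv := hH.hasDerivAt_integral_comp_exp_neg hF ht
  simp only [dilationDefect_comp_exp_neg hFφ, hFφ] at hderiv
  have hφm := hφ.continuous.measurable
  rw [hh.integral_mul_comp_sub hH ht (hH.levy.measurable_marchaudLeft hφm)]
  refine hderiv.congr_of_eventuallyEq ?_
  filter_upwards [lt_mem_nhds ht] with τ hτ using hh.integral_mul_comp_sub hH hτ hφm x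

theorem hasDerivAt_integral_backward {φ : ℝ → ℝ} (hφ : ContDiff ℝ 1 φ) (hzero : φ =ᶠ[atBot] 0)
    {t : ℝ} (ht : 0 < t) (y : ℝ) :
    HasDerivAt (fun τ => ∫ x, φ x * h τ (y - x))
      (-∫ x, marchaudRight ν φ x * h t (y - x)) t := by
  have hforward := hh.hasDerivAt_integral_forward hH (hφ.comp contDiff_neg)
    (hzero.comp_tendsto tendsto_neg_atTop_atBot) ht (-y)
  simpa only [Function.comp_def, marchaudLeft_comp_neg, integral_comp_neg_mul_comp_sub_neg] using
    hforward

theorem tendsto_integral_forward {φ : ℝ → ℝ} (hφm : Measurable φ) {C : ℝ} (hC : ∀ z, |φ z| ≤ C)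
    {x : ℝ} (hφ : ContinuousAt φ x) :
    Tendsto (fun t => ∫ y, φ y * h t (y - x)) (𝓝[>] 0) (𝓝 (φ x)) := by
  have := hH.isProbabilityMeasure
  have htime : Tendsto Real.toNNReal (𝓝[>] 0) (𝓝[≥] 0) := by
    refine tendsto_nhdsWithin_iff.2 ⟨?_, Eventually.of_forall fun t => mem_Ici.2 zero_le⟩
    simpa using (continuous_real_toNNReal.tendsto 0).mono_left nhdsWithin_le_nhds
  have hlim : Tendsto (fun t : ℝ => ∫ ω, φ (x + H t.toNNReal ω) ∂P) (𝓝[>] 0)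
      (𝓝 (∫ _, φ x ∂P)) := by
    refine tendsto_integral_filter_of_dominated_convergence (fun _ => C)
      (Eventually.of_forall fun t =>
        (hφm.comp ((hH.measurable t.toNNReal).const_add x)).aestronglyMeasurable)
      (Eventually.of_forall fun t => ae_of_all _ fun ω => hC _) (integrable_const C) ?_
    filter_upwards [hH.start_zero, hH.rightCont_paths] with ω h0 hrc
    have hpath : Tendsto (fun t : ℝ => x + H t.toNNReal ω) (𝓝[>] 0) (𝓝 x) := by
      simpa [h0] using ((hrc 0).tendsto.comp htime).const_add x
    exact hφ.tendsto.comp hpath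
  simp only [integral_const, probReal_univ, one_smul] at hlim
  refine hlim.congr' ?_
  filter_upwards [self_mem_nhdsWithin] with t ht using (hh.integral_mul_comp_sub hH ht hφm x).symm

theorem tendsto_integral_backward {φ : ℝ → ℝ} (hφm : Measurable φ) {C : ℝ} (hC : ∀ z, |φ z| ≤ C)
    {y : ℝ} (hφ : ContinuousAt φ y) :
    Tendsto (fun t => ∫ x, φ x * h t (y - x)) (𝓝[>] 0) (𝓝 (φ y)) := by
  have hneg : ContinuousAt (fun z => φ (-z)) (-y) :=
    ContinuousAt.comp (g := φ) (by rwa [neg_neg]) continuousAt_neg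
  have hforward := hh.tendsto_integral_forward hH (hφm.comp measurable_neg)
    (fun z => hC (-z)) hneg
  simpa only [Function.comp_def, neg_neg, integral_comp_neg_mul_comp_sub_neg] using hforward

end

end IsTransitionDensity

theorem integrable_one_sub_exp_neg {Ω : Type*} [MeasurableSpace Ω] {P : Measure Ω}
    [IsFiniteMeasure P] {X : Ω → ℝ} (hX : AEMeasurable X P) (hX0 : ∀ᵐ ω ∂P, 0 ≤ X ω) :
    Integrable (fun ω => 1 - Real.exp (-X ω)) P := by
  refine (integrable_const (1 : ℝ)).mono' (AEMeasurable.aestronglyMeasurable (by fun_prop)) ?_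
  filter_upwards [hX0] with ω hω
  obtain ⟨he0, he1⟩ := exp_neg_mem_Icc hω
  rw [Real.norm_of_nonneg (sub_nonneg.2 he1)]
  exact sub_le_self 1 he0

/-- `f` is Lipschitz on `s` for the metric `1 - e^{-|z - w|}`, that is, Lipschitz with bounded
oscillation. In this gauge increments integrate exactly: over jumps, `1 - e^{-s}` has `ν`-integral
`Φ(1)`, and along a subordinator, `1 - e^{-H_t}` has mean `1 - e^{-tΦ(1)}`. -/
def ExpLipschitzOn (C : ℝ) (f : ℝ → ℝ) (s : Set ℝ) : Prop :=
  ∀ z ∈ s, ∀ w ∈ s, |f z - f w| ≤ C * (1 - Real.exp (-|z - w|))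

namespace ExpLipschitzOn

theorem of_lipschitzOnWith {f : ℝ → ℝ} {s : Set ℝ} {K : ℝ≥0} (hf : LipschitzOnWith K f s) {B : ℝ}
    (hB : ∀ z ∈ s, |f z| ≤ B) : ExpLipschitzOn (max (K : ℝ) (2 * B) * 2) f s := fun z hz w hw => by
  have hle : |f z - f w| ≤ max (K : ℝ) (2 * B) * min 1 |z - w| := by
    rcases le_total |z - w| 1 with h | h
    · rw [min_eq_right h]
      exact (hf.dist_le_mul z hz w hw).trans (by gcongr; exacts [le_max_left _ _, le_rfl])
    · rw [min_eq_left h, mul_one]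
      refine (abs_sub _ _).trans (le_trans ?_ (le_max_right _ _))
      linarith [hB z hz, hB w hw]
  rw [mul_assoc]
  exact hle.trans (mul_le_mul_of_nonneg_left (min_one_le_two_mul_one_sub_exp_neg (abs_nonneg _))
    (K.2.trans (le_max_left _ _)))

theorem exists_univ_of_contDiff {φ : ℝ → ℝ} (hφ : ContDiff ℝ 1 φ) (hsupp : HasCompactSupport φ) :
    ∃ C, ExpLipschitzOn C φ univ := by
  obtain ⟨K, hK⟩ := hφ.lipschitzWith_of_hasCompactSupport hsupp one_ne_zero
  obtain ⟨B, hB⟩ := hsupp.exists_bound_of_continuous hφ.continuous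
  exact ⟨_, of_lipschitzOnWith hK.lipschitzOnWith fun z _ => hB z⟩

theorem exists_Iic_of_locallyLipschitz {f : ℝ → ℝ} (hf : LocallyLipschitz f)
    (hzero : ∀ z ≤ 0, f z = 0) (R : ℝ) : ∃ C, ExpLipschitzOn C f (Iic R) := by
  have hmax : ∀ z, f (max z 0) = f z := fun z => by
    rcases le_total z 0 with hz | hz
    · rw [max_eq_right hz, hzero z hz, hzero 0 le_rfl]
    · rw [max_eq_left hz]
  have hmem : MapsTo (fun z : ℝ => max z 0) (Iic R) (Icc 0 (max R 0)) := fun z hz =>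
    ⟨le_max_right _ _, max_le_max_right 0 hz⟩
  obtain ⟨K, hK⟩ := LocallyLipschitzOn.exists_lipschitzOnWith_of_compact
    (isCompact_Icc (a := (0 : ℝ)) (b := max R 0)) hf.locallyLipschitzOn
  obtain ⟨B, hB⟩ := isCompact_Icc.exists_bound_of_continuousOn (s := Icc 0 (max R 0))
    hf.continuous.continuousOn
  have hlip : LipschitzOnWith K f (Iic R) := by
    simpa only [mul_one, Function.comp_def, id, hmax] using
      hK.comp (LipschitzWith.id.max_const 0).lipschitzOnWith hmem
  exact ⟨_, of_lipschitzOnWith hlip fun z hz => by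
    simpa only [hmax, Real.norm_eq_abs] using hB _ (hmem hz)⟩

variable {C : ℝ} {f : ℝ → ℝ}

theorem continuousOn {s : Set ℝ} (hf : ExpLipschitzOn C f s) : ContinuousOn f s := fun z hz => by
  have hlim : Tendsto (fun w => C * (1 - Real.exp (-|w - z|))) (𝓝[s] z) (𝓝 0) := by
    have hcont : Continuous fun w => C * (1 - Real.exp (-|w - z|)) := by fun_prop
    simpa using (hcont.tendsto z).mono_left nhdsWithin_le_nhds
  refine tendsto_iff_dist_tendsto_zero.2 (squeeze_zero' (Eventually.of_forall fun _ => dist_nonneg)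
    ?_ hlim)
  filter_upwards [self_mem_nhdsWithin] with w hw using hf w hw z hz

theorem abs_sub_sub_le {R : ℝ} (hf : ExpLipschitzOn C f (Iic R)) {z : ℝ} (hz : z ≤ R) {s : ℝ}
    (hs : 0 ≤ s) : |f z - f (z - s)| ≤ C * (1 - Real.exp (-s)) := by
  simpa only [sub_sub_cancel, abs_of_nonneg hs] using
    hf z hz (z - s) (mem_Iic.2 ((sub_le_self z hs).trans hz))

section Average

variable {R : ℝ} (hf : ExpLipschitzOn C f (Iic R)) {Ω : Type*} [MeasurableSpace Ω] {P : Measure Ω}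
  {X : Ω → ℝ} (hX : AEMeasurable X P) (hX0 : ∀ᵐ ω ∂P, 0 ≤ X ω)
include hf hX hX0

theorem abs_integral_sub_comp_sub_le [IsFiniteMeasure P] {z : ℝ} (hz : z ≤ R) :
    |∫ ω, (f z - f (z - X ω)) ∂P| ≤ C * ∫ ω, (1 - Real.exp (-X ω)) ∂P := by
  rw [← integral_const_mul]
  refine norm_integral_le_of_norm_le (f := fun ω => f z - f (z - X ω))
    ((integrable_one_sub_exp_neg hX hX0).const_mul C) ?_
  filter_upwards [hX0] with ω hω using hf.abs_sub_sub_le hz hω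

variable (hfm : Measurable f)
include hfm

theorem integrable_comp_sub [IsFiniteMeasure P] {z : ℝ} (hz : z ≤ R) :
    Integrable (fun ω => f (z - X ω)) P := by
  have hdiff : Integrable (fun ω => f z - f (z - X ω)) P := by
    refine ((integrable_one_sub_exp_neg hX hX0).const_mul C).mono'
      (AEMeasurable.aestronglyMeasurable (by fun_prop)) ?_
    filter_upwards [hX0] with ω hω using hf.abs_sub_sub_le hz hω
  simpa only [Pi.sub_def, sub_sub_cancel] using (integrable_const (f z)).sub hdiff

theorem integral_comp_sub [IsProbabilityMeasure P] :
    ExpLipschitzOn C (fun z => ∫ ω, f (z - X ω) ∂P) (Iic R) :=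
  fun z hz w hw => by
  rw [← integral_sub (hf.integrable_comp_sub hX hX0 hfm hz)
    (hf.integrable_comp_sub hX hX0 hfm hw)]
  have hbound : ∀ᵐ ω ∂P, ‖f (z - X ω) - f (w - X ω)‖ ≤ C * (1 - Real.exp (-|z - w|)) := by
    filter_upwards [hX0] with ω hω
    simpa only [sub_sub_sub_cancel_right, Real.norm_eq_abs] using
      hf (z - X ω) (mem_Iic.2 ((sub_le_self z hω).trans hz))
        (w - X ω) (mem_Iic.2 ((sub_le_self w hω).trans hw))
  simpa using norm_integral_le_of_norm_le_const hbound

end Average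

end ExpLipschitzOn

section Adjoint

variable {ν : Measure ℝ} {φ f : ℝ → ℝ}

theorem integral_sub_comp_add_mul (hφ : Continuous φ) {B : ℝ} (hB : ∀ y, ‖φ y‖ ≤ B)
    (hf : Integrable f) (s : ℝ) :
    ∫ y, (φ y - φ (y + s)) * f y = ∫ y, φ y * (f y - f (y - s)) := by
  have hφf : Integrable fun y => φ y * f y :=
    hf.bdd_mul hφ.aestronglyMeasurable (ae_of_all _ hB)
  have hφsf : Integrable fun y => φ (y + s) * f y :=
    hf.bdd_mul (Continuous.aestronglyMeasurable (by fun_prop)) (ae_of_all _ fun y => hB (y + s))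
  have hφfs : Integrable fun y => φ y * f (y - s) :=
    (hf.comp_sub_right s).bdd_mul hφ.aestronglyMeasurable (ae_of_all _ hB)
  simp only [sub_mul, mul_sub]
  rw [integral_sub hφf hφsf, integral_sub hφf hφfs,
    ← integral_add_right_eq_self (fun y => φ y * f (y - s)) s]
  simp only [add_sub_cancel_right]

variable (hν : IsSubordinatorLevyMeasure ν) (hfm : Measurable f)
include hν hfm

theorem integrable_uncurry_sub_comp_add_mul (hφm : Measurable φ) {A : ℝ}
    (hA : ExpLipschitzOn A φ univ) (hf : Integrable f) :
    Integrable (Function.uncurry fun y s => (φ y - φ (y + s)) * f y)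
      (volume.prod (ν.restrict (Ioi 0))) := by
  have := hν.sFinite_restrict_Ioi
  refine ((hf.norm.mul_prod hν.integrableOn_one_sub_exp_neg).const_mul A).mono'
    (Measurable.aestronglyMeasurable (by unfold Function.uncurry; fun_prop)) ?_
  have hpos : ∀ᵐ p : ℝ × ℝ ∂volume.prod (ν.restrict (Ioi 0)), 0 < p.2 :=
    Measure.quasiMeasurePreserving_snd.ae (ae_restrict_mem measurableSet_Ioi)
  filter_upwards [hpos] with p hp
  have hφp : ‖φ p.1 - φ (p.1 + p.2)‖ ≤ A * (1 - Real.exp (-p.2)) := by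
    simpa [abs_of_pos hp] using hA p.1 (mem_univ _) (p.1 + p.2) (mem_univ _)
  calc ‖(φ p.1 - φ (p.1 + p.2)) * f p.1‖ ≤ A * (1 - Real.exp (-p.2)) * ‖f p.1‖ := by
        rw [norm_mul]
        gcongr
    _ = A * (‖f p.1‖ * (1 - Real.exp (-p.2))) := by ring

theorem integrable_uncurry_mul_sub_comp_sub (hφ : Continuous φ) (hsupp : HasCompactSupport φ)
    {C : ℝ≥0} (hC : ∀ y ∈ tsupport φ, ∫⁻ s in Ioi (0 : ℝ), ‖f y - f (y - s)‖ₑ ∂ν ≤ C) :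
    Integrable (Function.uncurry fun y s => φ y * (f y - f (y - s)))
      (volume.prod (ν.restrict (Ioi 0))) := by
  have := hν.sFinite_restrict_Ioi
  refine ⟨Measurable.aestronglyMeasurable (by unfold Function.uncurry; fun_prop), ?_⟩
  rw [HasFiniteIntegral, lintegral_prod _ (by unfold Function.uncurry; fun_prop)]
  have hle : ∀ y, ∫⁻ s in Ioi (0 : ℝ), ‖φ y * (f y - f (y - s))‖ₑ ∂ν ≤ ‖φ y‖ₑ * C := fun y => by
    simp only [enorm_mul]
    rw [lintegral_const_mul _ (by fun_prop)]
    by_cases hy : y ∈ tsupport φ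
    · gcongr
      exact hC y hy
    · simp [image_eq_zero_of_notMem_tsupport hy]
  refine (lintegral_mono hle).trans_lt ?_
  rw [lintegral_mul_const _ (by fun_prop)]
  exact ENNReal.mul_lt_top (hφ.integrable_of_hasCompactSupport hsupp).2 ENNReal.coe_lt_top

theorem integral_marchaudLeft_mul (hφ : ContDiff ℝ 1 φ) (hsupp : HasCompactSupport φ)
    (hf : Integrable f) {C : ℝ≥0}
    (hC : ∀ y ∈ tsupport φ, ∫⁻ s in Ioi (0 : ℝ), ‖f y - f (y - s)‖ₑ ∂ν ≤ C) :
    ∫ y, marchaudLeft ν φ y * f y = ∫ y, φ y * marchaudRight ν f y := by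
  have := hν.sFinite_restrict_Ioi
  have hφc := hφ.continuous
  obtain ⟨A, hA⟩ := ExpLipschitzOn.exists_univ_of_contDiff hφ hsupp
  obtain ⟨B, hB⟩ := hsupp.exists_bound_of_continuous hφc
  calc ∫ y, marchaudLeft ν φ y * f y
      = ∫ y, ∫ s in Ioi (0 : ℝ), (φ y - φ (y + s)) * f y ∂ν := by
        simp only [marchaudLeft, integral_mul_const]
    _ = ∫ s in Ioi (0 : ℝ), (∫ y, (φ y - φ (y + s)) * f y) ∂ν :=
        integral_integral_swap (integrable_uncurry_sub_comp_add_mul hν hfm hφc.measurable hA hf)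
    _ = ∫ s in Ioi (0 : ℝ), (∫ y, φ y * (f y - f (y - s))) ∂ν := by
        simp only [integral_sub_comp_add_mul hφc hB hf]
    _ = ∫ y, ∫ s in Ioi (0 : ℝ), φ y * (f y - f (y - s)) ∂ν :=
        (integral_integral_swap (integrable_uncurry_mul_sub_comp_sub hν hfm hφc hsupp hC)).symm
    _ = ∫ y, φ y * marchaudRight ν f y := by simp only [marchaudRight, integral_const_mul]

end Adjoint

theorem tsupport_comp_const_sub {G E : Type*} [TopologicalSpace G] [AddCommGroup G]
    [IsTopologicalAddGroup G] [Zero E] (φ : G → E) (z : G) :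
    tsupport (fun y => φ (z - y)) = (z - ·) ⁻¹' tsupport φ :=
  ((Homeomorph.subLeft z).preimage_closure (Function.support φ)).symm

section WeakDerivative

variable {G : Type*} [NormedAddCommGroup G] [NormedSpace ℝ G] [FiniteDimensional ℝ G]
  [MeasurableSpace G] [BorelSpace G] (μ : Measure G) [μ.IsAddHaarMeasure]
  {E : Type*} [NormedAddCommGroup E] [NormedSpace ℝ E] [CompleteSpace E] {V : Set G} {z : G}

theorem exists_seq_contDiff_tendsto_integral_smul (ι : Type*) (hV : V ∈ 𝓝 z) :
    ∃ φ : ℕ → G → ℝ,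
      (∀ n, ContDiff ℝ (⊤ : ℕ∞) (φ n) ∧ HasCompactSupport (φ n) ∧ tsupport (φ n) ⊆ V) ∧
      ∀ (g : ι → G → E) (l : Filter ι) (c : E), (∀ᶠ i in l, AEStronglyMeasurable (g i) μ) →
        Tendsto (Function.uncurry g) (l ×ˢ 𝓝 z) (𝓝 c) →
        Tendsto (fun p : ℕ × ι => ∫ y, φ p.1 y • g p.2 y ∂μ) (atTop ×ˢ l) (𝓝 c) := by
  obtain ⟨ε, hε, hεV⟩ := Metric.nhds_basis_closedBall.mem_iff.1 hV
  let b (n : ℕ) : ContDiffBump (0 : G) :=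
    ⟨ε / (n + 1) / 2, ε / (n + 1), by positivity, half_lt_self (by positivity)⟩
  have hb : Tendsto (fun n => (b n).rOut) atTop (𝓝 0) := by
    simpa only [mul_one_div, mul_zero] using
      (tendsto_one_div_add_atTop_nhds_zero_nat (𝕜 := ℝ)).const_mul ε
  refine ⟨fun n y => (b n).normed μ (z - y), fun n => ⟨?_, ?_, ?_⟩, fun g l c hg hlim => ?_⟩
  · exact ((b n).contDiff_normed (n := ⊤)).comp (contDiff_const.sub contDiff_id)
  · exact (b n).hasCompactSupport_normed.comp_homeomorph (Homeomorph.subLeft z)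
  · refine Subset.trans (fun y hy => ?_) hεV
    rw [tsupport_comp_const_sub, (b n).tsupport_normed_eq, mem_preimage,
      mem_closedBall_zero_iff, ← dist_eq_norm'] at hy
    exact Metric.mem_closedBall.2 (hy.trans (div_le_self hε.le (by simp)))
  · simp only [← convolution_lsmul_swap]
    refine ContDiffBump.convolution_tendsto_right (φ := fun p : ℕ × ι => b p.1)
      (g := fun p => g p.2) (hb.comp tendsto_fst) (tendsto_snd.eventually hg) ?_ tendsto_const_nhds
    exact hlim.comp (tendsto_snd.prodMap tendsto_id)

theorem hasDerivAt_of_forall_hasDerivAt_integral_smul {u f : ℝ → G → E} {s : Set ℝ}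
    (hs : IsOpen s) (hV : V ∈ 𝓝 z) (hum : ∀ τ ∈ s, AEStronglyMeasurable (u τ) μ)
    (hfm : ∀ τ ∈ s, AEStronglyMeasurable (f τ) μ) (huc : ∀ τ ∈ s, ContinuousAt (u τ) z)
    (hfc : ∀ τ ∈ s, ContinuousAt (Function.uncurry f) (τ, z))
    (hweak : ∀ φ : G → ℝ, ContDiff ℝ (⊤ : ℕ∞) φ → HasCompactSupport φ → tsupport φ ⊆ V →
      ∀ τ ∈ s, HasDerivAt (fun σ => ∫ y, φ y • u σ y ∂μ) (∫ y, φ y • f τ y ∂μ) τ)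
    {t : ℝ} (ht : t ∈ s) : HasDerivAt (fun τ => u τ z) (f t z) t := by
  obtain ⟨φ, hφ, hlim⟩ := exists_seq_contDiff_tendsto_integral_smul (E := E) μ ℝ hV
  refine hasDerivAt_of_tendstoLocallyUniformlyOn (l := atTop) (g' := fun τ => f τ z) hs
    ((IsOpen.tendstoLocallyUniformlyOn_iff_forall_tendsto hs).2 fun τ hτ => ?_)
    (Eventually.of_forall fun n => hweak (φ n) (hφ n).1 (hφ n).2.1 (hφ n).2.2) (fun τ hτ => ?_) ht
  · have hfz : Tendsto (fun σ => f σ z) (𝓝 τ) (𝓝 (f τ z)) :=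
      (hfc τ hτ).tendsto.comp (Continuous.prodMk_left z).continuousAt
    have hφf := hlim f (𝓝 τ) (f τ z) (eventually_of_mem (hs.mem_nhds hτ) hfm)
      (nhds_prod_eq (x := τ) (y := z) ▸ (hfc τ hτ).tendsto)
    exact ((hfz.comp tendsto_snd).prodMk_nhds hφf).mono_right (nhds_le_uniformity _)
  · have hφu := hlim u (pure τ) (u τ z) (hum τ hτ)
      (by rw [pure_prod, tendsto_map'_iff]; exact (huc τ hτ).tendsto)
    exact hφu.comp (tendsto_id.prodMk tendsto_const_pure)

end WeakDerivative

theorem eventuallyEq_zero_of_hasCompactSupport {X E : Type*} [TopologicalSpace X] [R1Space X]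
    [Zero E] {φ : X → E} (hφ : HasCompactSupport φ) {l : Filter X} (hl : l ≤ cocompact X) :
    φ =ᶠ[l] 0 :=
  (hasCompactSupport_iff_eventuallyEq.1 hφ).filter_mono
    (hl.trans coclosedCompact_eq_cocompact.ge)

namespace MarchaudRegular

variable {Ω : Type*} [MeasurableSpace Ω] {P : Measure Ω} {H : ℝ≥0 → Ω → ℝ} {ν : Measure ℝ}
  {h : ℝ → ℝ → ℝ}

theorem integrableOn (hreg : MarchaudRegular ν h) {t z : ℝ} (hm : Measurable (h t)) (ht : 0 < t)
    (hz : 0 < z) : IntegrableOn (fun s => h t z - h t (z - s)) (Ioi 0) ν := by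
  obtain ⟨C, hC⟩ := hreg.bounded {(t, z)} isCompact_singleton (singleton_subset_iff.2 ⟨ht, hz⟩)
  exact ⟨Measurable.aestronglyMeasurable (by fun_prop),
    (hC (t, z) rfl).trans_lt ENNReal.coe_lt_top⟩

variable (hreg : MarchaudRegular ν h) (hH : IsDriftlessSubordinator P H ν)
  (hh : IsTransitionDensity P H h)
include hreg hH hh

theorem hasDerivAt_integral {φ : ℝ → ℝ} (hφ : ContDiff ℝ 1 φ) (hsupp : HasCompactSupport φ)
    (hpos : tsupport φ ⊆ Ioi 0) {t : ℝ} (ht : 0 < t) :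
    HasDerivAt (fun τ => ∫ y, φ y * h τ y) (-∫ y, φ y * marchaudRight ν (h t) y) t := by
  obtain ⟨C, hC⟩ := hreg.bounded ({t} ×ˢ tsupport φ) (isCompact_singleton.prod hsupp.isCompact)
    (prod_mono (singleton_subset_iff.2 ht) hpos)
  rw [← integral_marchaudLeft_mul hH.levy (hh.measurable t ht) hφ hsupp (hh.integrable hH ht)
    fun y hy => hC (t, y) ⟨rfl, hy⟩]
  simpa only [sub_zero] using hh.hasDerivAt_integral_forward hH hφ
    (eventuallyEq_zero_of_hasCompactSupport hsupp atTop_le_cocompact) ht 0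

theorem hasDerivAt {t z : ℝ} (ht : 0 < t) (hz : 0 < z) :
    HasDerivAt (fun τ => h τ z) (-marchaudRight ν (h t) z) t := by
  have hnhds : ∀ τ ∈ Ioi (0 : ℝ), Ioi (0 : ℝ) ×ˢ Ioi (0 : ℝ) ∈ 𝓝 (τ, z) := fun τ hτ =>
    prod_mem_nhds (Ioi_mem_nhds hτ) (Ioi_mem_nhds hz)
  refine hasDerivAt_of_forall_hasDerivAt_integral_smul volume (s := Ioi 0) (V := Ioi 0)
    (f := fun τ y => -marchaudRight ν (h τ) y) isOpen_Ioi (Ioi_mem_nhds hz)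
    (fun τ hτ => (hh.measurable τ hτ).aestronglyMeasurable)
    (fun τ hτ => (hH.levy.measurable_marchaudRight (hh.measurable τ hτ)).neg.aestronglyMeasurable)
    (fun τ hτ => ?_) (fun τ hτ => (hreg.marchaud_continuousOn.continuousAt (hnhds τ hτ)).neg)
    (fun φ hφ hsupp hpos τ hτ => ?_) ht
  · exact (hreg.continuousOn.continuousAt (hnhds τ hτ)).comp
      (Continuous.prodMk_right τ).continuousAt
  · simpa only [smul_eq_mul, mul_neg, integral_neg] using
      hreg.hasDerivAt_integral hH hh (hφ.of_le (mod_cast le_top)) hsupp hpos hτ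

end MarchaudRegular

namespace IsTransitionDensity

variable {Ω : Type*} [MeasurableSpace Ω] {P : Measure Ω} {H : ℝ≥0 → Ω → ℝ} {ν : Measure ℝ}
  {h : ℝ → ℝ → ℝ} (hH : IsDriftlessSubordinator P H ν) (hh : IsTransitionDensity P H h)
include hH hh

theorem ae_eq_integral {s t : ℝ} (hs : 0 < s) (ht : 0 < t) :
    h (s + t) =ᵐ[volume] fun z => ∫ ω, h t (z - H s.toNNReal ω) ∂P := by
  have hst := add_pos hs ht
  have hms := (hh.measurable s hs).ennreal_ofReal
  have hmt := (hh.measurable t ht).ennreal_ofReal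
  have hconv := hH.map_add s.toNNReal t.toNNReal
  rw [← Real.toNNReal_add hs.le ht.le, hh.map_toNNReal hs, hh.map_toNNReal ht,
    hh.map_toNNReal hst, conv_withDensity_eq_lconvolution hms hmt,
    withDensity_eq_iff_of_sigmaFinite (hh.measurable _ hst).ennreal_ofReal.aemeasurable
      (measurable_lconvolution volume hms hmt).aemeasurable] at hconv
  filter_upwards [hconv] with z hz
  have hm : Measurable fun w => h t (z - w) := (hh.measurable t ht).comp (by fun_prop)
  calc h (s + t) z
      = (∫⁻ w, ENNReal.ofReal (h s w) * ENNReal.ofReal (h t (z - w))).toReal := by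
        rw [← ENNReal.toReal_ofReal (hh.nonneg _ hst z), hz, lconvolution_def]
        simp only [sub_eq_neg_add]
    _ = (∫⁻ ω, ENNReal.ofReal (h t (z - H s.toNNReal ω)) ∂P).toReal := by
        rw [← lintegral_map hm.ennreal_ofReal (hH.measurable _), hh.map_toNNReal hs,
          lintegral_withDensity_eq_lintegral_mul _ hms hm.ennreal_ofReal]
        rfl
    _ = ∫ ω, h t (z - H s.toNNReal ω) ∂P :=
        (integral_eq_lintegral_of_nonneg_ae (ae_of_all _ fun ω => hh.nonneg t ht _)
          (hm.comp (hH.measurable _)).aestronglyMeasurable).symm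

variable (hlip : ∀ t, 0 < t → LocallyLipschitz (h t))
include hlip

theorem eq_integral {s t : ℝ} (hs : 0 < s) (ht : 0 < t) (z : ℝ) :
    h (s + t) z = ∫ ω, h t (z - H s.toNNReal ω) ∂P := by
  have := hH.isProbabilityMeasure
  obtain ⟨C, hC⟩ := ExpLipschitzOn.exists_Iic_of_locallyLipschitz (hlip t ht) (hh.eq_zero t ht)
    (z + 1)
  have havg := hC.integral_comp_sub (hH.measurable s.toNNReal).aemeasurable
    (hH.ae_nonneg s.toNNReal) (hh.measurable t ht)
  exact Measure.eqOn_open_of_ae_eq (ae_restrict_of_ae (hh.ae_eq_integral hH hs ht)) isOpen_Iio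
    (hlip _ (add_pos hs ht)).continuous.continuousOn (havg.continuousOn.mono Iio_subset_Iic_self)
    (mem_Iio.2 (lt_add_one z))

theorem exists_expLipschitzOn {t₀ : ℝ} (ht₀ : 0 < t₀) (R : ℝ) :
    ∃ C, ∀ t, t₀ ≤ t → ExpLipschitzOn C (h t) (Iic R) := by
  have := hH.isProbabilityMeasure
  obtain ⟨C, hC⟩ := ExpLipschitzOn.exists_Iic_of_locallyLipschitz (hlip t₀ ht₀)
    (hh.eq_zero t₀ ht₀) R
  refine ⟨C, fun t ht => ?_⟩
  rcases ht.eq_or_lt with rfl | hlt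
  · exact hC
  · have havg := hC.integral_comp_sub (hH.measurable (t - t₀).toNNReal).aemeasurable
      (hH.ae_nonneg _) (hh.measurable t₀ ht₀)
    simpa only [← hh.eq_integral hH hlip (sub_pos.2 hlt) ht₀, sub_add_cancel] using havg

theorem abs_sub_le_of_lt {t t' R C z : ℝ} (ht : 0 < t) (htt' : t < t')
    (hC : ExpLipschitzOn C (h t) (Iic R)) (hz : z ≤ R) :
    |h t z - h t' z| ≤ C * (1 - Real.exp (-((t' - t) * levySymbol ν 1))) := by
  have := hH.isProbabilityMeasure
  have hs := sub_pos.2 htt'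
  have hX := (hH.measurable (t' - t).toNNReal).aemeasurable (μ := P)
  have hX0 := hH.ae_nonneg (t' - t).toNNReal
  have hdiff : ∫ ω, (h t z - h t (z - H (t' - t).toNNReal ω)) ∂P = h t z - h t' z := by
    rw [integral_sub (integrable_const _) (hC.integrable_comp_sub hX hX0 (hh.measurable t ht) hz),
      ← hh.eq_integral hH hlip hs ht, sub_add_cancel, integral_const, probReal_univ, one_smul]
  have hle := hC.abs_integral_sub_comp_sub_le hX hX0 hz
  rwa [hdiff, hH.integral_one_sub_exp_neg, Real.coe_toNNReal _ hs.le] at hle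

theorem abs_sub_le {t₀ t t' R C z : ℝ} (ht₀ : 0 < t₀) (ht : t₀ ≤ t) (ht' : t₀ ≤ t')
    (hC : ∀ τ, t₀ ≤ τ → ExpLipschitzOn C (h τ) (Iic R)) (hz : z ≤ R) :
    |h t z - h t' z| ≤ C * (1 - Real.exp (-(|t - t'| * levySymbol ν 1))) := by
  rcases lt_trichotomy t t' with hlt | rfl | hlt
  · rw [abs_sub_comm t t', abs_of_pos (sub_pos.2 hlt)]
    exact hh.abs_sub_le_of_lt hH hlip (ht₀.trans_le ht) hlt (hC t ht) hz
  · simp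
  · rw [abs_sub_comm, abs_of_pos (sub_pos.2 hlt)]
    exact hh.abs_sub_le_of_lt hH hlip (ht₀.trans_le ht') hlt (hC t' ht') hz

theorem continuousAt_uncurry_of_locallyLipschitz {t : ℝ} (ht : 0 < t) (z : ℝ) :
    ContinuousAt (fun p : ℝ × ℝ => h p.1 p.2) (t, z) := by
  obtain ⟨C, hC⟩ := hh.exists_expLipschitzOn hH hlip (half_pos ht) (z + 1)
  have hlim : Tendsto (fun p : ℝ × ℝ => C * (1 - Real.exp (-|p.2 - z|)) +
      C * (1 - Real.exp (-(|p.1 - t| * levySymbol ν 1)))) (𝓝 (t, z)) (𝓝 0) := by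
    have hcont : Continuous fun p : ℝ × ℝ => C * (1 - Real.exp (-|p.2 - z|)) +
      C * (1 - Real.exp (-(|p.1 - t| * levySymbol ν 1))) := by fun_prop
    simpa using hcont.tendsto (t, z)
  refine tendsto_iff_dist_tendsto_zero.2
    (squeeze_zero' (Eventually.of_forall fun _ => dist_nonneg) ?_ hlim)
  filter_upwards [prod_mem_nhds (Ici_mem_nhds (half_lt_self ht)) (Iic_mem_nhds (lt_add_one z))]
    with p hp
  have hz : z ≤ z + 1 := (lt_add_one z).le
  exact (dist_triangle _ (h p.1 z) _).trans (add_le_add (hC p.1 hp.1 p.2 hp.2 z hz)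
    (hh.abs_sub_le hH hlip (half_pos ht) hp.1 (half_le_self ht.le) hC hz))

theorem continuousAt_marchaudRight_of_locallyLipschitz {t : ℝ} (ht : 0 < t) (z : ℝ) :
    ContinuousAt (fun p : ℝ × ℝ => marchaudRight ν (h p.1) p.2) (t, z) := by
  obtain ⟨C, hC⟩ := hh.exists_expLipschitzOn hH hlip (half_pos ht) (z + 1)
  have hcont := hh.continuousAt_uncurry_of_locallyLipschitz hH hlip ht
  have hnhds : Ici (t / 2) ×ˢ Iic (z + 1) ∈ 𝓝 (t, z) :=
    prod_mem_nhds (Ici_mem_nhds (half_lt_self ht)) (Iic_mem_nhds (lt_add_one z))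
  refine continuousAt_of_dominated (bound := fun s => C * (1 - Real.exp (-s))) ?_ ?_
    (hH.levy.integrableOn_one_sub_exp_neg.const_mul C) (ae_of_all _ fun s => ?_)
  · filter_upwards [hnhds] with p hp
    have hm := hh.measurable p.1 ((half_pos ht).trans_le hp.1)
    exact Measurable.aestronglyMeasurable (by fun_prop)
  · filter_upwards [hnhds] with p hp
    filter_upwards [ae_restrict_mem measurableSet_Ioi] with s hs
    exact (hC p.1 hp.1).abs_sub_sub_le hp.2 (le_of_lt hs)
  · have hshift : ContinuousAt (fun p : ℝ × ℝ => (p.1, p.2 - s)) (t, z) := by fun_prop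
    exact (hcont z).sub ((hcont (z - s)).tendsto.comp hshift)

theorem marchaudRegular_of_locallyLipschitz : MarchaudRegular ν h where
  continuousOn := fun p hp =>
    (hh.continuousAt_uncurry_of_locallyLipschitz hH hlip hp.1 p.2).continuousWithinAt
  bounded K hK hpos := by
    rcases K.eq_empty_or_nonempty with rfl | hne
    · exact ⟨0, by simp⟩
    obtain ⟨p₀, hp₀, hmin⟩ := hK.exists_isMinOn hne continuous_fst.continuousOn
    obtain ⟨p₁, hp₁, hmax⟩ := hK.exists_isMaxOn hne continuous_snd.continuousOn
    obtain ⟨C, hC⟩ := hh.exists_expLipschitzOn hH hlip (hpos hp₀).1 p₁.2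
    exact ⟨(C * levySymbol ν 1).toNNReal, fun p hp =>
      hH.levy.setLIntegral_enorm_le fun s hs =>
        (hC p.1 (hmin hp)).abs_sub_sub_le (hmax hp) (le_of_lt hs)⟩
  marchaud_continuousOn := fun p hp =>
    (hh.continuousAt_marchaudRight_of_locallyLipschitz hH hlip hp.1 p.2).continuousWithinAt

end IsTransitionDensity

theorem theorem3p2_general {Ω : Type*} [MeasurableSpace Ω] {P : Measure Ω} {H : ℝ≥0 → Ω → ℝ}
    {ν : Measure ℝ} (hH : IsDriftlessSubordinator P H ν) {h : ℝ → ℝ → ℝ}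
    (hh : IsTransitionDensity P H h) :
    (∀ (t : ℝ≥0) (x : ℝ), 0 < t →
      P.map (fun ω => x + H t ω) = volume.withDensity fun y => ENNReal.ofReal (h t (y - x))) ∧
    (((∀ t, 0 < t → LocallyLipschitz (h t)) ∨ MarchaudRegular ν h) →
      ∀ t x y : ℝ, 0 < t → x < y →
        IntegrableOn (fun s => h t (y - x) - h t (y - s - x)) (Ioi 0) ν ∧
        IntegrableOn (fun s => h t (y - x) - h t (y - (x + s))) (Ioi 0) ν ∧
        HasDerivAt (fun τ => h τ (y - x)) (-marchaudRight ν (fun y' => h t (y' - x)) y) t ∧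
        HasDerivAt (fun τ => h τ (y - x)) (-marchaudLeft ν (fun x' => h t (y - x')) x) t) ∧
    (∀ φ : ℝ → ℝ, ContDiff ℝ 1 φ →
      (φ =ᶠ[atTop] 0 → ∀ t x : ℝ, 0 < t →
        HasDerivAt (fun τ => ∫ y, φ y * h τ (y - x))
          (-∫ y, marchaudLeft ν φ y * h t (y - x)) t) ∧
      (φ =ᶠ[atBot] 0 → ∀ t y : ℝ, 0 < t →
        HasDerivAt (fun τ => ∫ x, φ x * h τ (y - x))
          (-∫ x, marchaudRight ν φ x * h t (y - x)) t)) ∧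
    (∀ φ : ℝ → ℝ, Measurable φ → (∃ C, ∀ z, |φ z| ≤ C) →
      (∀ x : ℝ, ContinuousAt φ x →
        Tendsto (fun t => ∫ y, φ y * h t (y - x)) (𝓝[>] 0) (𝓝 (φ x))) ∧
      (∀ y : ℝ, ContinuousAt φ y →
        Tendsto (fun t => ∫ x, φ x * h t (y - x)) (𝓝[>] 0) (𝓝 (φ y)))) := by
  refine ⟨fun t x ht => hh.map_const_add hH ht x, fun hreg t x y ht hxy => ?_,
    fun φ hφ => ⟨fun hzero t x ht => hh.hasDerivAt_integral_forward hH hφ hzero ht x,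
      fun hzero t y ht => hh.hasDerivAt_integral_backward hH hφ hzero ht y⟩,
    fun φ hφm ⟨_, hC⟩ => ⟨fun _ hφ => hh.tendsto_integral_forward hH hφm hC hφ,
      fun _ hφ => hh.tendsto_integral_backward hH hφm hC hφ⟩⟩
  have hregular : MarchaudRegular ν h := hreg.elim (hh.marchaudRegular_of_locallyLipschitz hH) id
  have hz : 0 < y - x := sub_pos.2 hxy
  have hint := hregular.integrableOn (hh.measurable t ht) ht hz
  have hderiv := hregular.hasDerivAt hH hh ht hz
  simp only [marchaudRight, marchaudLeft, sub_add_eq_sub_sub, sub_right_comm y _ x]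
  exact ⟨hint, hint, hderiv, hderiv⟩

theorem theorem3p2 {Ω : Type*} [MeasurableSpace Ω] (P : Measure Ω) [IsProbabilityMeasure P]
    (H : ℝ≥0 → Ω → ℝ) (ν : Measure ℝ) (hH : IsDriftlessSubordinator P H ν)
    (hinf : ν (Ioi 0) = ∞)
    (h : ℝ → ℝ → ℝ) (hh : IsTransitionDensity P H h) :
    -- `y ↦ h t (y - x)` is the density of `x + H t`
    (∀ (t : ℝ≥0) (x : ℝ), 0 < t →
      P.map (fun ω => x + H t ω) = volume.withDensity fun y => ENNReal.ofReal (h t (y - x))) ∧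
    -- the two equations in the classical sense, as soon as `h` has the regularity for that
    (((∀ t, 0 < t → LocallyLipschitz (h t)) ∨ MarchaudRegular ν h) →
      ∀ t x y : ℝ, 0 < t → 0 < x → x < y →
        IntegrableOn (fun s => h t (y - x) - h t (y - s - x)) (Ioi 0) ν ∧
        IntegrableOn (fun s => h t (y - x) - h t (y - (x + s))) (Ioi 0) ν ∧
        HasDerivAt (fun τ => h τ (y - x)) (-marchaudRight ν (fun y' => h t (y' - x)) y) t ∧
        HasDerivAt (fun τ => h τ (y - x)) (-marchaudLeft ν (fun x' => h t (y - x')) x) t) ∧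
    -- the two equations in the sense of distributions, in `y` and in `x`, for any density
    (∀ φ : ℝ → ℝ, ContDiff ℝ (⊤ : ℕ∞) φ → HasCompactSupport φ →
      (∀ t x : ℝ, 0 < t →
        HasDerivAt (fun τ => ∫ y, φ y * h τ (y - x))
          (-∫ y, marchaudLeft ν φ y * h t (y - x)) t) ∧
      (∀ t y : ℝ, 0 < t →
        HasDerivAt (fun τ => ∫ x, φ x * h τ (y - x))
          (-∫ x, marchaudRight ν φ x * h t (y - x)) t)) ∧
    -- the initial condition `δ(y - x)`, as a measure in `y` and in `x`
    (∀ φ : ℝ → ℝ, Continuous φ → (∃ C, ∀ z, |φ z| ≤ C) →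
      (∀ x : ℝ, Tendsto (fun t => ∫ y, φ y * h t (y - x)) (𝓝[>] 0) (𝓝 (φ x))) ∧
      (∀ y : ℝ, Tendsto (fun t => ∫ x, φ x * h t (y - x)) (𝓝[>] 0) (𝓝 (φ y)))) := by
  obtain ⟨hlaw, hclassical, hweak, hinit⟩ := theorem3p2_general hH hh
  refine ⟨hlaw, fun hreg t x y ht _ => hclassical hreg t x y ht, fun φ hφ hsupp => ?_,
    fun φ hφ hC => (hinit φ hφ.measurable hC).imp (fun hx x => hx x hφ.continuousAt)
      fun hy y => hy y hφ.continuousAt⟩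
  exact (hweak φ (hφ.of_le (mod_cast le_top))).imp
    (· (eventuallyEq_zero_of_hasCompactSupport hsupp atTop_le_cocompact))
    (· (eventuallyEq_zero_of_hasCompactSupport hsupp atBot_le_cocompact))
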